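/- Let $d\ge 1$. A point $F\in\overline{\mathrm{Rat}_d(\mathbb C)}:=\mathbb P^{2d+1}_{\mathbb C}$ is a pair $(P:Q)$ of homogeneous polynomials of degree $d$ in two variables, not both zero, given by their coefficients up to a common nonzero scalar. Write $P=Hp$, $Q=Hq$ with $H=\gcd(P,Q)$; the degree of $F$ is the degree of the rational map $\varphi_F=(p:q)$. The space $\mathrm{Rat}_d(\mathbb C)\subset\mathbb P^{2d+1}_{\mathbb C}$ consists of the $(P:Q)$ for which $P$ and $Q$ have no (nonconstant) common divisor; such a point is regarded as the rational map $(z:w)\mapsto(P(z,w):Q(z,w))$ of $\mathbb P^1_{\mathbb C}$, hence, by stereographic projection, as a map $S^2\to S^2$. Let $\mathbb H^3$ be the open unit ball of $\mathbb R^3$ with the hyperbolic metric, let $\mu_{S^2}$ be the rotation-invariant probability measure on $S^2=\partial\mathbb H^3$, and call a measure $\mu$ on $S^2$ balanced at $y\in\mathbb H^3$ if $\int_{S^2}\zeta\,d(M_*\mu)(\zeta)=0\in\mathbb R^3$, where $M$ is an isometry of $\mathbb H^3$ (extended to $S^2$) with $M(y)=\mathbf 0$. For $f\in\mathrm{Rat}_d(\mathbb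 C)$, the barycentric extension $\mathscr E f$ sends $\mathbf 0$ to the unique point of $\mathbb H^3$ at which $f_*\mu_{S^2}$ is balanced. Let $(f_n)$ be a sequence in $\mathrm{Rat}_d(\mathbb C)$. Then the points $\mathscr E f_n(\mathbf 0)$ are well defined (for each $n$ there is exactly one point of $\mathbb H^3$ at which $(f_n)_*\mu_{S^2}$ is balanced), and they stay at bounded hyperbolic distance from $\mathbf 0$ if and only if the limit set of $(f_n)$ in $\overline{\mathrm{Rat}_d(\mathbb C)}$, that is, the set of limits of convergent subsequences, contains no point of degree $0$. -/

import Mathlib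

open MeasureTheory

noncomputable section

namespace BarExt

/-! ### The ball model of hyperbolic 3-space and its boundary sphere -/

/-- Euclidean 3-space. -/
abbrev E3 : Type := EuclideanSpace ℝ (Fin 3)

/-- The unit sphere `S²`. -/
abbrev S2 : Type := Metric.sphere (0 : E3) 1

/-- Hyperbolic 3-space, as the open unit ball. -/
abbrev H3 : Type := Metric.ball (0 : E3) 1

/-- The origin of the ball. -/
def origin : H3 := ⟨0, by simp⟩

/-- The hyperbolic distance (curvature `-1`) in the ball model. -/
def hypDist (x y : H3) : ℝ :=
  2 * Real.arsinh (‖(x : E3) - y‖ /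
    Real.sqrt ((1 - ‖(x : E3)‖ ^ 2) * (1 - ‖(y : E3)‖ ^ 2)))

/-- The formula for the hyperbolic isometry `M_x`, which sends `0` to `x` and has inverse
`M_{-x}`; it makes sense on the closed ball. -/
def mobius (x z : E3) : E3 :=
  (1 + ‖x‖ ^ 2 * ‖z‖ ^ 2 + 2 * inner ℝ x z)⁻¹ •
    ((1 - ‖x‖ ^ 2) • z + (1 + ‖z‖ ^ 2 + 2 * inner ℝ x z) • x)

theorem norm_mobius {x z : E3} (hx : ‖x‖ < 1) (hz : ‖z‖ = 1) : ‖mobius x z‖ = 1 := by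
  have hc : |inner ℝ x z| ≤ ‖x‖ * ‖z‖ := abs_real_inner_le_norm x z
  rw [hz, mul_one] at hc
  have hc1 := (abs_le.mp hc).1
  have hpos : 0 < 1 + ‖x‖ ^ 2 * ‖z‖ ^ 2 + 2 * inner ℝ x z := by
    rw [hz]
    nlinarith [sq_nonneg (1 - ‖x‖), mul_pos (sub_pos.2 hx) (sub_pos.2 hx)]
  have hn : ‖(1 - ‖x‖ ^ 2) • z + (1 + ‖z‖ ^ 2 + 2 * inner ℝ x z) • x‖ ^ 2
      = (1 + ‖x‖ ^ 2 * ‖z‖ ^ 2 + 2 * inner ℝ x z) ^ 2 := by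
    rw [norm_add_sq_real, norm_smul, norm_smul, real_inner_smul_left, real_inner_smul_right,
      real_inner_comm x z, mul_pow, mul_pow, Real.norm_eq_abs, Real.norm_eq_abs, sq_abs, sq_abs,
      hz]
    ring
  have hn' := (sq_eq_sq₀ (norm_nonneg _) hpos.le).1 hn
  rw [mobius, norm_smul, hn', norm_inv, Real.norm_eq_abs, abs_of_pos hpos,
    inv_mul_cancel₀ hpos.ne']

/-- The boundary values `M_x : S² → S²` of the hyperbolic isometry `M_x`. -/
def mobiusSphere (x : H3) (ζ : S2) : S2 :=
  ⟨mobius x ζ, by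
    have hx : ‖(x : E3)‖ < 1 := mem_ball_zero_iff.1 x.2
    have hz : ‖(ζ : E3)‖ = 1 := by simp
    simpa using norm_mobius hx hz⟩

/-! ### Barycenters and the barycentric extension -/

/-- The rotation-invariant probability measure on `S²`. -/
def sphereMeasure : Measure S2 :=
  ((volume : Measure E3).toSphere Set.univ)⁻¹ • (volume : Measure E3).toSphere

/-- A measure on `S²` is balanced if its Euclidean center of mass is `0`. -/
def Balanced (μ : Measure S2) : Prop :=
  ∫ ζ, (ζ : E3) ∂μ = 0

/-- A measure on `S²` is balanced at `y` if its image under the hyperbolic isometry `M_{-y}`,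
which sends `y` to `0`, is balanced. -/
def BalancedAt (μ : Measure S2) (y : H3) : Prop :=
  Balanced (μ.map (mobiusSphere (-y)))

open Classical in
/-- The barycenter of `μ`: the unique point at which `μ` is balanced
(the origin if there is no such unique point). -/
def barycenter (μ : Measure S2) : H3 :=
  if h : ∃! y : H3, BalancedAt μ y then h.choose else origin

/-- The barycentric extension of `f : S² → S²`. -/
def barycentricExtension (f : S2 → S2) (x : H3) : H3 :=
  barycenter (sphereMeasure.map (f ∘ mobiusSphere x))

/-! ### The Riemann sphere -/

/-- The complex projective line. -/
abbrev P1 : Type := Projectivization ℂ (Fin 2 → ℂ)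

/-- The point of `S²` with homogeneous coordinates `(v 0 : v 1)`
under stereographic projection from the north pole. -/
def stereoVec (v : Fin 2 → ℂ) : E3 :=
  (Complex.normSq (v 0) + Complex.normSq (v 1))⁻¹ •
    !₂[2 * (v 0 * (starRingEnd ℂ) (v 1)).re, 2 * (v 0 * (starRingEnd ℂ) (v 1)).im,
      Complex.normSq (v 0) - Complex.normSq (v 1)]

theorem normSq_add_pos {v : Fin 2 → ℂ} (hv : v ≠ 0) :
    0 < Complex.normSq (v 0) + Complex.normSq (v 1) := by
  by_contra h
  have h0 := Complex.normSq_nonneg (v 0)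
  have h1 := Complex.normSq_nonneg (v 1)
  have e0 : v 0 = 0 := Complex.normSq_eq_zero.1 (le_antisymm (by linarith) h0)
  have e1 : v 1 = 0 := Complex.normSq_eq_zero.1 (le_antisymm (by linarith) h1)
  apply hv
  ext i
  fin_cases i <;> simp [e0, e1]

theorem norm_stereoVec {v : Fin 2 → ℂ} (hv : v ≠ 0) : ‖stereoVec v‖ = 1 := by
  have hp := normSq_add_pos hv
  have h : ‖stereoVec v‖ ^ 2 = 1 := by
    rw [EuclideanSpace.norm_sq_eq, Fin.sum_univ_three]
    simp only [stereoVec, PiLp.smul_apply, smul_eq_mul, Real.norm_eq_abs, sq_abs, mul_pow,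
      Matrix.cons_val_zero, Matrix.cons_val_one, Matrix.cons_val]
    rw [← mul_add, ← mul_add, inv_pow, inv_mul_eq_one₀ (by positivity)]
    simp only [Complex.normSq_apply, Complex.mul_re, Complex.mul_im, Complex.conj_re,
      Complex.conj_im]
    ring
  exact (sq_eq_sq₀ (norm_nonneg _) zero_le_one).1 (by rw [h, one_pow])

theorem stereoVec_smul (v : Fin 2 → ℂ) {t : ℂ} (ht : t ≠ 0) :
    stereoVec (t • v) = stereoVec v := by
  have ht' : Complex.normSq t ≠ 0 := by simpa using ht
  have e : (t * v 0) * (starRingEnd ℂ) (t * v 1)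
      = (Complex.normSq t : ℂ) * (v 0 * (starRingEnd ℂ) (v 1)) := by
    rw [map_mul, Complex.normSq_eq_conj_mul_self]; ring
  have key : (Complex.normSq t * Complex.normSq (v 0) + Complex.normSq t * Complex.normSq (v 1))⁻¹
      = (Complex.normSq t)⁻¹ * (Complex.normSq (v 0) + Complex.normSq (v 1))⁻¹ := by
    rw [← mul_add, mul_inv]
  unfold stereoVec
  simp only [Pi.smul_apply, smul_eq_mul]
  rw [e, Complex.re_ofReal_mul, Complex.im_ofReal_mul, Complex.normSq_mul, Complex.normSq_mul, key]
  ext i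
  fin_cases i <;> simp only [PiLp.smul_apply, smul_eq_mul] <;> simp <;> field_simp

/-- Stereographic projection as a map from the projective line to `S²`. -/
def toS2 : P1 → S2 :=
  Projectivization.lift (fun v => (⟨stereoVec v.1, by simpa using norm_stereoVec v.2⟩ : S2))
    (by
      rintro ⟨a, ha⟩ ⟨b, hb⟩ t (h : a = t • b)
      have ht : t ≠ 0 := by rintro rfl; simp [h] at ha
      ext1
      simp only [h]
      exact stereoVec_smul b ht)

open Classical in
/-- The inverse map: `(a, b, c) ↦ (a + i b : 1 - c)`, and the north pole goes to `(1 : 0)`. -/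
def ofS2 (ζ : S2) : P1 :=
  if h : (ζ : E3) 2 = 1 then Projectivization.mk ℂ ![1, 0] (by simp)
  else Projectivization.mk ℂ ![⟨(ζ : E3) 0, (ζ : E3) 1⟩, ((1 - (ζ : E3) 2 : ℝ) : ℂ)] (by
    intro h0
    have := congrFun h0 1
    simp only [Matrix.cons_val_one, Matrix.cons_val_zero, Pi.zero_apply,
      Complex.ofReal_eq_zero] at this
    exact h (by linarith))

theorem S2_eq (ζ : S2) : (ζ : E3) 0 ^ 2 + (ζ : E3) 1 ^ 2 + (ζ : E3) 2 ^ 2 = 1 := by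
  have hz : ‖(ζ : E3)‖ ^ 2 = 1 := by simp
  rw [EuclideanSpace.norm_sq_eq, Fin.sum_univ_three] at hz
  simpa using hz

theorem toS2_ofS2 (ζ : S2) : toS2 (ofS2 ζ) = ζ := by
  have hS := S2_eq ζ
  unfold ofS2
  split_ifs with h
  · have h0 : (ζ : E3) 0 = 0 := by rw [h] at hS; nlinarith [sq_nonneg ((ζ : E3) 1)]
    have h1 : (ζ : E3) 1 = 0 := by rw [h] at hS; nlinarith [sq_nonneg ((ζ : E3) 0)]
    rw [toS2, Projectivization.lift_mk]
    ext i
    fin_cases i <;> simp [stereoVec, h, h0, h1]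
  · rw [toS2, Projectivization.lift_mk]
    have hc : 1 - (ζ : E3) 2 ≠ 0 := fun h' => h (by linarith)
    have e : (ζ : E3) 0 * (ζ : E3) 0 + (ζ : E3) 1 * (ζ : E3) 1
        + (1 - (ζ : E3) 2) * (1 - (ζ : E3) 2) = 2 * (1 - (ζ : E3) 2) := by linear_combination hS
    have e2 : (ζ : E3) 0 * (ζ : E3) 0 + (ζ : E3) 1 * (ζ : E3) 1
        - (1 - (ζ : E3) 2) * (1 - (ζ : E3) 2) = 2 * (1 - (ζ : E3) 2) * (ζ : E3) 2 := by
      linear_combination hS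
    ext i
    simp only [stereoVec, PiLp.smul_apply, smul_eq_mul, Matrix.cons_val_zero,
      Matrix.cons_val_one, Complex.normSq_apply, Complex.ofReal_re, Complex.ofReal_im,
      Complex.mul_re, Complex.mul_im, Complex.conj_re, Complex.conj_im, mul_zero, add_zero,
      neg_zero, sub_zero, e, e2, zero_add]
    fin_cases i <;> simp <;> field_simp

theorem ofS2_toS2 (x : P1) : ofS2 (toS2 x) = x := by
  induction x using Projectivization.ind with
  | h v hv =>
    have hp := normSq_add_pos hv
    have h2 : ((toS2 (Projectivization.mk ℂ v hv) : S2) : E3) 2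
        = (Complex.normSq (v 0) + Complex.normSq (v 1))⁻¹ *
          (Complex.normSq (v 0) - Complex.normSq (v 1)) := by
      simp [toS2, stereoVec]
    have h0 : ((toS2 (Projectivization.mk ℂ v hv) : S2) : E3) 0
        = (Complex.normSq (v 0) + Complex.normSq (v 1))⁻¹ *
          (2 * (v 0 * (starRingEnd ℂ) (v 1)).re) := by
      simp [toS2, stereoVec]
    have h1 : ((toS2 (Projectivization.mk ℂ v hv) : S2) : E3) 1
        = (Complex.normSq (v 0) + Complex.normSq (v 1))⁻¹ *
          (2 * (v 0 * (starRingEnd ℂ) (v 1)).im) := by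
      simp [toS2, stereoVec]
    unfold ofS2
    split_ifs with h
    · rw [h2, inv_mul_eq_one₀ hp.ne'] at h
      have hv1 : v 1 = 0 := Complex.normSq_eq_zero.1 (by linarith)
      rw [Projectivization.mk_eq_mk_iff']
      have hv0 : v 0 ≠ 0 := by
        intro h0
        apply hv
        ext i
        fin_cases i <;> simp [h0, hv1]
      refine ⟨(v 0)⁻¹, ?_⟩
      ext i
      fin_cases i <;> simp [hv0, hv1]
    · rw [Projectivization.mk_eq_mk_iff']
      refine ⟨((Complex.normSq (v 0) + Complex.normSq (v 1))⁻¹ * 2 : ℝ) *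
        (starRingEnd ℂ) (v 1), ?_⟩
      simp only [h0, h1, h2]
      ext i
      fin_cases i
      · apply Complex.ext <;>
          simp only [Pi.smul_apply, smul_eq_mul, Fin.zero_eta, Matrix.cons_val_zero,
            Complex.mul_re, Complex.mul_im, Complex.conj_re, Complex.conj_im, Complex.ofReal_re,
            Complex.ofReal_im] <;> ring
      · have e : 1 - (Complex.normSq (v 0) + Complex.normSq (v 1))⁻¹ *
            (Complex.normSq (v 0) - Complex.normSq (v 1))
            = (Complex.normSq (v 0) + Complex.normSq (v 1))⁻¹ * 2 * Complex.normSq (v 1) := by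
          field_simp
          ring
        simp only [Pi.smul_apply, smul_eq_mul, Fin.mk_one, Matrix.cons_val_one,
          Matrix.cons_val_zero, e]
        rw [mul_assoc, ← Complex.normSq_eq_conj_mul_self]
        push_cast
        ring

/-- The identification of the Riemann sphere `ℙ¹(ℂ)` with `S²` by stereographic projection. -/
def riemannSphere : P1 ≃ S2 where
  toFun := toS2
  invFun := ofS2
  left_inv := ofS2_toS2
  right_inv := toS2_ofS2

/-! ### Rational maps and the compactification of `Rat_d` -/

/-- The quotient topology on a projective space. -/
instance projectivizationTopology {V : Type*} [AddCommGroup V] [Module ℂ V]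
    [TopologicalSpace V] : TopologicalSpace (Projectivization ℂ V) :=
  TopologicalSpace.coinduced (fun v : {v : V // v ≠ 0} => Projectivization.mk ℂ v.1 v.2)
    inferInstance

/-- The compactification `ℙ^{2d+1}(ℂ)` of `Rat_d`: pairs `(P : Q)` of binary forms of
degree `d`, given by their coefficients, not both zero and up to a common scalar. -/
abbrev RatBar (d : ℕ) : Type := Projectivization ℂ (Fin 2 → Fin (d + 1) → ℂ)

/-- The binary form `∑ aᵢ zⁱ w^(d-i)` of degree `d`. -/
def form {d : ℕ} (a : Fin (d + 1) → ℂ) : MvPolynomial (Fin 2) ℂ :=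
  ∑ i : Fin (d + 1), MvPolynomial.C (a i) * MvPolynomial.X 0 ^ (i : ℕ) *
    MvPolynomial.X 1 ^ (d - (i : ℕ))

/-- The two forms `P = poly F 0`, `Q = poly F 1` of a point `F = (P : Q)`
(defined up to a common nonzero scalar). -/
def poly {d : ℕ} (F : RatBar d) (j : Fin 2) : MvPolynomial (Fin 2) ℂ :=
  form (F.rep j)

/-- The space `Rat_d` of rational maps of degree `d`: the points `(P : Q)` such that `P` and `Q`
have no common divisor. -/
def Rat (d : ℕ) : Set (RatBar d) :=
  {F | IsRelPrime (poly F 0) (poly F 1)}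

/-- `F = (P : Q)` has degree `e` if `P = H p` and `Q = H q`, where `H = gcd(P, Q)` and
the rational map `φ_F = (p : q)` in lowest terms has degree `e`. -/
def HasDegree {d : ℕ} (F : RatBar d) (e : ℕ) : Prop :=
  ∃ H p q : MvPolynomial (Fin 2) ℂ, p.IsHomogeneous e ∧ q.IsHomogeneous e ∧
    IsRelPrime p q ∧ poly F 0 = H * p ∧ poly F 1 = H * q

/-- The limit set of a sequence: the set of limits of its subsequences. -/
def limitSet {X : Type*} [TopologicalSpace X] (u : ℕ → X) : Set X :=
  {x | ∃ φ : ℕ → ℕ, StrictMono φ ∧ Filter.Tendsto (u ∘ φ) Filter.atTop (nhds x)}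

theorem eval_form {d : ℕ} (a : Fin (d + 1) → ℂ) (v : Fin 2 → ℂ) :
    MvPolynomial.eval v (form a) = ∑ i : Fin (d + 1), a i * v 0 ^ (i : ℕ) * v 1 ^ (d - (i : ℕ)) := by
  simp [form]

theorem eval_form_smul {d : ℕ} (a : Fin (d + 1) → ℂ) (t : ℂ) (v : Fin 2 → ℂ) :
    MvPolynomial.eval (t • v) (form a) = t ^ d * MvPolynomial.eval v (form a) := by
  rw [eval_form, eval_form, Finset.mul_sum]
  refine Finset.sum_congr rfl fun i _ => ?_
  have hi : t ^ d = t ^ (i : ℕ) * t ^ (d - (i : ℕ)) := by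
    rw [← pow_add, Nat.add_sub_cancel' (Nat.lt_succ_iff.1 i.2)]
  simp only [Pi.smul_apply, smul_eq_mul, mul_pow, hi]
  ring

/-- The linear form vanishing at `(v 0 : v 1)`. -/
def lin (v : Fin 2 → ℂ) : MvPolynomial (Fin 2) ℂ :=
  MvPolynomial.C (v 1) * MvPolynomial.X 0 - MvPolynomial.C (v 0) * MvPolynomial.X 1

theorem lin_dvd_form {d : ℕ} (a : Fin (d + 1) → ℂ) {v : Fin 2 → ℂ} (hv : v ≠ 0)
    (h : MvPolynomial.eval v (form a) = 0) : lin v ∣ form a := by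
  rw [← Ideal.mem_span_singleton, ← Ideal.Quotient.eq_zero_iff_mem]
  set π := Ideal.Quotient.mk (Ideal.span {lin v})
  have hl : π (MvPolynomial.C (v 1)) * π (MvPolynomial.X 0)
      = π (MvPolynomial.C (v 0)) * π (MvPolynomial.X 1) := by
    rw [← map_mul, ← map_mul, ← sub_eq_zero, ← map_sub]
    exact Ideal.Quotient.eq_zero_iff_mem.2 (Ideal.mem_span_singleton_self _)
  have hv' : v 0 ≠ 0 ∨ v 1 ≠ 0 := by
    by_contra! hh
    exact hv (by ext i; fin_cases i <;> simp [hh.1, hh.2])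
  rw [eval_form] at h
  obtain ⟨j, y, hj, hx0, hx1⟩ : ∃ (j : Fin 2) (y : MvPolynomial (Fin 2) ℂ ⧸ Ideal.span {lin v}),
      v j ≠ 0 ∧ π (MvPolynomial.X 0) = π (MvPolynomial.C (v 0)) * y ∧
        π (MvPolynomial.X 1) = π (MvPolynomial.C (v 1)) * y := by
    have inv : ∀ c : ℂ, c ≠ 0 → π (MvPolynomial.C c) * π (MvPolynomial.C c⁻¹) = 1 := by
      intro c hc
      rw [← map_mul, ← map_mul, mul_inv_cancel₀ hc, map_one, map_one]
    rcases hv' with h0 | h1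
    · refine ⟨0, π (MvPolynomial.C (v 0)⁻¹) * π (MvPolynomial.X 0), h0, ?_, ?_⟩
      · rw [← mul_assoc, inv _ h0, one_mul]
      · linear_combination (-π (MvPolynomial.X 1)) * inv _ h0 - π (MvPolynomial.C (v 0)⁻¹) * hl
    · refine ⟨1, π (MvPolynomial.C (v 1)⁻¹) * π (MvPolynomial.X 1), h1, ?_, ?_⟩
      · linear_combination (-π (MvPolynomial.X 0)) * inv _ h1 + π (MvPolynomial.C (v 1)⁻¹) * hl
      · rw [← mul_assoc, inv _ h1, one_mul]
  have e : π (form a) = π (MvPolynomial.C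
      (∑ i : Fin (d + 1), a i * v 0 ^ (i : ℕ) * v 1 ^ (d - (i : ℕ)))) * y ^ d := by
    simp only [form, map_sum, map_mul, map_pow, hx0, hx1, Finset.sum_mul]
    refine Finset.sum_congr rfl fun i _ => ?_
    have hi : y ^ d = y ^ (i : ℕ) * y ^ (d - (i : ℕ)) := by
      rw [← pow_add, Nat.add_sub_cancel' (Nat.lt_succ_iff.1 i.2)]
    rw [hi]
    ring
  rw [e, h, map_zero, map_zero, zero_mul]

theorem not_isUnit_lin {v : Fin 2 → ℂ} : ¬ IsUnit (lin v) := by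
  intro h
  have := h.map (MvPolynomial.eval (0 : Fin 2 → ℂ))
  simp [lin] at this

theorem eval_ne_zero {d : ℕ} (F : Rat d) {v : Fin 2 → ℂ} (hv : v ≠ 0) :
    (fun j => MvPolynomial.eval v (poly F.1 j)) ≠ (0 : Fin 2 → ℂ) := by
  intro h
  exact not_isUnit_lin (F.2 (lin_dvd_form _ hv (congrFun h 0)) (lin_dvd_form _ hv (congrFun h 1)))

/-- The self-map `(z : w) ↦ (P(z, w) : Q(z, w))` of the projective line
defined by `(P : Q) ∈ Rat_d`. -/
def ratMap {d : ℕ} (F : Rat d) : P1 → P1 :=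
  Projectivization.lift
    (fun v => Projectivization.mk ℂ (fun j => MvPolynomial.eval v.1 (poly F.1 j))
      (eval_ne_zero F v.2))
    (by
      rintro ⟨a, ha⟩ ⟨b, hb⟩ t (h : a = t • b)
      rw [Projectivization.mk_eq_mk_iff']
      refine ⟨t ^ d, ?_⟩
      ext j
      simp only [h, Pi.smul_apply, smul_eq_mul, poly, eval_form_smul])

/-- The same map, as a self-map of `S²`. -/
def sphereMap {d : ℕ} (F : Rat d) : S2 → S2 :=
  fun ζ => riemannSphere (ratMap F (riemannSphere.symm ζ))

end BarExt

end

noncomputable section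

namespace BarExt

open Filter Topology

/-! ### The isometries `M_{-y}` and Busemann functions -/

/-! Everything rests on the balance integral of `mobius (-y)` against a measure ν on the sphere. For
a map f it is the integral of `mobius (-y) (f ζ)` against `sphereMeasure`.

Exactly one balanced point: the pushforward has no atoms, since the fibres of a rational map of
degree d ≥ 1 are finite. By `busemannExp_div`, a ratio of two Busemann exponentials is affine in
`mobius (-y) z`, with constant term cosh of the distance and linear part of norm sinh of the
distance. If ν is balanced at two distinct points, the ratio and its inverse both have mean cosh,
the largest possible mean of the two together, and equality concentrates ν on two points
(`balancedAt_unique`). For existence, minimize the integrated Busemann function on balls of radius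
tending to 1. An interior minimizer is balanced; minimizers that all lie on the boundary spheres
accumulate at a boundary point ξ, where absence of atoms sends the balance integral to -ξ, against
the first-order condition (`exists_balancedAt`).

Boundedness: along a subsequence let f_n tend to F and the barycenters to y₀ in the closed ball. The
values f_n(ζ) tend to φ_F(ζ) off finitely many ζ, so if φ_F avoids y₀ almost everywhere, the balance
equation survives in the limit (`integral_mobius_limit`). If F has degree 0 and y₀ is interior, the
limiting integral is the unit vector `mobius (-y₀) c`, with c the constant value. If F has positive
degree and y₀ is on the sphere, it is -y₀. Neither vanishes, so degenerate limits of degree 0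
correspond exactly to barycenters escaping to infinity. Compactness of `RatBar d` supplies the
subsequences. -/

theorem mobius_zero (z : E3) : mobius 0 z = z := by simp [mobius]

theorem one_add_neg_inner {y z : E3} (hz : ‖z‖ = 1) :
    1 + ‖-y‖ ^ 2 * ‖z‖ ^ 2 + 2 * inner ℝ (-y) z = ‖z - y‖ ^ 2 := by
  rw [norm_sub_sq_real, norm_neg, inner_neg_left, hz, real_inner_comm]
  ring

theorem norm_sub_sq_pos {y z : E3} (hy : ‖y‖ < 1) (hz : ‖z‖ = 1) : 0 < ‖z - y‖ ^ 2 := by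
  have : z - y ≠ 0 := by
    intro h
    rw [sub_eq_zero] at h
    rw [h] at hz
    linarith
  positivity

theorem one_sub_norm_sq_pos {y : E3} (hy : ‖y‖ < 1) : 0 < 1 - ‖y‖ ^ 2 := by
  nlinarith [norm_nonneg y]

/-- On the sphere the isometry is an inversion centred at `y` followed by a translation. This form
shows both its injectivity and its collapse to `-y` when `‖y‖ = 1`. -/
theorem mobius_neg {y z : E3} (hz : ‖z‖ = 1) (hyz : ‖z - y‖ ^ 2 ≠ 0) :
    mobius (-y) z = ((1 - ‖y‖ ^ 2) / ‖z - y‖ ^ 2) • (z - y) - y := by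
  have hs : ‖z - y‖ ^ 2 = 1 - 2 * inner ℝ y z + ‖y‖ ^ 2 := by
    rw [norm_sub_sq_real, hz, real_inner_comm]; ring
  have h2 : 1 + ‖z‖ ^ 2 + 2 * inner ℝ (-y) z = ‖z - y‖ ^ 2 + (1 - ‖y‖ ^ 2) := by
    rw [hs, hz, inner_neg_left]; ring
  rw [mobius, one_add_neg_inner hz, h2, norm_neg]
  have hn : ‖z - y‖ ≠ 0 := fun h => hyz (by rw [h]; norm_num)
  match_scalars <;> field_simp
  ring

/-- The denominator is `‖z - y‖ ^ 2`, so the diagonal is the only obstruction; `y` may lie on the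
boundary sphere, as the limiting arguments require. -/
theorem continuousAt_mobius_neg {y z : E3} (hz : ‖z‖ = 1) (hyz : z ≠ y) :
    ContinuousAt (fun p : E3 × E3 => mobius (-p.1) p.2) (y, z) := by
  have h0 : 1 + ‖-y‖ ^ 2 * ‖z‖ ^ 2 + 2 * inner ℝ (-y) z ≠ 0 := by
    rw [one_add_neg_inner hz]
    have := sub_ne_zero.2 hyz
    positivity
  have h1 : Continuous fun p : E3 × E3 =>
      1 + ‖-p.1‖ ^ 2 * ‖p.2‖ ^ 2 + 2 * inner ℝ (-p.1) p.2 := by fun_prop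
  have h2 : Continuous fun p : E3 × E3 =>
      (1 - ‖-p.1‖ ^ 2) • p.2 + (1 + ‖p.2‖ ^ 2 + 2 * inner ℝ (-p.1) p.2) • -p.1 := by fun_prop
  have h3 := (h1.continuousAt (x := (y, z))).inv₀ h0
  exact h3.smul (h2.continuousAt (x := (y, z)))

theorem continuous_mobius_neg {y : E3} (hy : ‖y‖ < 1) :
    Continuous fun ζ : S2 => mobius (-y) ζ := by
  refine continuous_iff_continuousAt.2 fun ζ => ?_
  have hz : ‖(ζ : E3)‖ = 1 := by simp
  have h : (ζ : E3) ≠ y := fun h => by rw [← h] at hy; linarith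
  exact (continuousAt_mobius_neg hz h).comp
    (f := fun ζ : S2 => (y, (ζ : E3))) (by fun_prop)

theorem norm_mobius_neg {y z : E3} (hy : ‖y‖ < 1) (hz : ‖z‖ = 1) : ‖mobius (-y) z‖ = 1 :=
  norm_mobius (by rwa [norm_neg]) hz

theorem continuous_mobiusSphere (x : H3) : Continuous (mobiusSphere x) := by
  have hx : ‖-(x : E3)‖ < 1 := by rw [norm_neg]; exact mem_ball_zero_iff.1 x.2
  refine Continuous.subtype_mk ?_ _
  simpa using continuous_mobius_neg hx

/-- The exponential of the Busemann function of `H3` at the boundary point `z`. -/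
def busemannExp (y z : E3) : ℝ := ‖z - y‖ ^ 2 / (1 - ‖y‖ ^ 2)

theorem busemannExp_pos {y z : E3} (hy : ‖y‖ < 1) (hz : ‖z‖ = 1) : 0 < busemannExp y z :=
  div_pos (norm_sub_sq_pos hy hz) (one_sub_norm_sq_pos hy)

/-- The hyperbolic cosine of the hyperbolic distance of two points of `H3`. -/
def coshDist (y x : E3) : ℝ := 1 + 2 * ‖y - x‖ ^ 2 / ((1 - ‖y‖ ^ 2) * (1 - ‖x‖ ^ 2))

theorem coshDist_comm (y x : E3) : coshDist y x = coshDist x y := by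
  rw [coshDist, coshDist, norm_sub_rev, mul_comm (1 - ‖y‖ ^ 2)]

/-- The linear part of `busemannExp x z / busemannExp y z`, as an affine function of
`mobius (-y) z`. -/
def ratioVec (y x : E3) : E3 :=
  (2 / (1 - ‖x‖ ^ 2)) • (y - x + (‖y - x‖ ^ 2 / (1 - ‖y‖ ^ 2)) • y)

theorem busemannExp_div {y x z : E3} (hy : ‖y‖ < 1) (hx : ‖x‖ < 1) (hz : ‖z‖ = 1) :
    busemannExp x z / busemannExp y z
      = coshDist y x + inner ℝ (ratioVec y x) (mobius (-y) z) := by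
  have hN := norm_sub_sq_pos hy hz
  have ha := one_sub_norm_sq_pos hy
  have hb := one_sub_norm_sq_pos hx
  rw [mobius_neg hz hN.ne', busemannExp, busemannExp, coshDist, ratioVec]
  simp only [inner_sub_right, inner_smul_left, inner_smul_right, inner_add_left, inner_sub_left,
    real_inner_self_eq_norm_sq, RCLike.conj_to_real]
  have hs : inner ℝ y z = (1 + ‖y‖ ^ 2 - ‖z - y‖ ^ 2) / 2 := by
    rw [norm_sub_sq_real, hz, real_inner_comm]; ring
  rw [norm_sub_sq_real z x, norm_sub_sq_real y x, hz, real_inner_comm y x,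
    real_inner_comm x z, hs]
  have hn : ‖z - y‖ ≠ 0 := fun h => hN.ne' (by rw [h]; norm_num)
  field_simp
  ring

/-- With d the hyperbolic distance, the norm is sinh d, so the ratio in `busemannExp_div` ranges
over [e^(-d), e^d]. -/
theorem norm_ratioVec_sq {y x : E3} (hy : ‖y‖ < 1) (hx : ‖x‖ < 1) :
    ‖ratioVec y x‖ ^ 2 = coshDist y x ^ 2 - 1 := by
  have ha := one_sub_norm_sq_pos hy
  have hb := one_sub_norm_sq_pos hx
  rw [← real_inner_self_eq_norm_sq, coshDist, ratioVec]
  simp only [inner_smul_left, inner_smul_right, inner_add_left, inner_sub_left, inner_add_right,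
    inner_sub_right, real_inner_self_eq_norm_sq, RCLike.conj_to_real]
  rw [norm_sub_sq_real y x, real_inner_comm y x]
  field_simp
  ring

theorem one_lt_coshDist {y x : E3} (hy : ‖y‖ < 1) (hx : ‖x‖ < 1) (h : y ≠ x) :
    1 < coshDist y x := by
  have ha := one_sub_norm_sq_pos hy
  have hb := one_sub_norm_sq_pos hx
  have := sub_ne_zero.2 h
  rw [coshDist, lt_add_iff_pos_right]
  positivity

/-! ### Barycenters of measures without atoms -/

theorem integrable_of_continuous (ν : Measure S2) [IsFiniteMeasure ν] {E : Type*}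
    [NormedAddCommGroup E] {g : S2 → E} (hg : Continuous g) : Integrable g ν :=
  hg.integrable_of_hasCompactSupport (HasCompactSupport.of_compactSpace g)

theorem balancedAt_iff (ν : Measure S2) (y : H3) :
    BalancedAt ν y ↔ ∫ ζ : S2, mobius (-(y : E3)) ζ ∂ν = 0 := by
  rw [BalancedAt, Balanced, integral_map (continuous_mobiusSphere _).aemeasurable
    continuous_subtype_val.aestronglyMeasurable]
  rfl

theorem integral_busemannExp_div (ν : Measure S2) [IsProbabilityMeasure ν] {y x : E3}
    (hy : ‖y‖ < 1) (hx : ‖x‖ < 1) :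
    ∫ ζ : S2, busemannExp x ζ / busemannExp y ζ ∂ν
      = coshDist y x + inner ℝ (ratioVec y x) (∫ ζ : S2, mobius (-y) ζ ∂ν) := by
  have hi := integrable_of_continuous ν (continuous_mobius_neg hy)
  have e : ∀ ζ : S2, busemannExp x ζ / busemannExp y ζ
      = coshDist y x + inner ℝ (ratioVec y x) (mobius (-y) ζ) := fun ζ =>
    busemannExp_div hy hx (by simp)
  simp_rw [e]
  rw [integral_add (integrable_const _) (hi.const_inner _), integral_inner hi]
  simp

theorem integrable_busemannExp_div (ν : Measure S2) [IsProbabilityMeasure ν] {y x : E3}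
    (hy : ‖y‖ < 1) (hx : ‖x‖ < 1) :
    Integrable (fun ζ : S2 => busemannExp x ζ / busemannExp y ζ) ν := by
  have hi := integrable_of_continuous ν (continuous_mobius_neg hy)
  have e : ∀ ζ : S2, busemannExp x ζ / busemannExp y ζ
      = coshDist y x + inner ℝ (ratioVec y x) (mobius (-y) ζ) := fun ζ =>
    busemannExp_div hy hx (by simp)
  simp_rw [e]
  exact (integrable_const _).add (hi.const_inner _)

theorem mobius_neg_injOn {y z z' : E3} (hy : ‖y‖ < 1) (hz : ‖z‖ = 1) (hz' : ‖z'‖ = 1)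
    (h : mobius (-y) z = mobius (-y) z') : z = z' := by
  have hN := norm_sub_sq_pos hy hz
  have hN' := norm_sub_sq_pos hy hz'
  have ha := one_sub_norm_sq_pos hy
  rw [mobius_neg hz hN.ne', mobius_neg hz' hN'.ne', sub_left_inj] at h
  have hn : ∀ w : E3, ‖w‖ ^ 2 ≠ 0 →
      ‖((1 - ‖y‖ ^ 2) / ‖w‖ ^ 2) • w‖ ^ 2 = (1 - ‖y‖ ^ 2) ^ 2 / ‖w‖ ^ 2 := by
    intro w hw
    rw [norm_smul, mul_pow, Real.norm_eq_abs, sq_abs]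
    field_simp
  have h1 := congrArg (fun v => ‖v‖ ^ 2) h
  simp only [hn _ hN.ne', hn _ hN'.ne'] at h1
  have h2 : ‖z - y‖ ^ 2 = ‖z' - y‖ ^ 2 := by
    rw [div_eq_div_iff hN.ne' hN'.ne'] at h1
    exact (mul_left_cancel₀ (by positivity) h1).symm
  rw [h2] at h
  have := smul_right_injective E3 (div_pos ha hN').ne' h
  exact sub_left_injective this

/-- On the interval with endpoints C ± √(C² - 1), which are mutually inverse, q + 1/q ≤ 2C with
equality only at the endpoints. Balance at both points makes the integral of q + 1/q equal to 2C. -/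
theorem balancedAt_unique {ν : Measure S2} [IsProbabilityMeasure ν] (hν : ∀ c, ν {c} = 0)
    {y x : H3} (hy : BalancedAt ν y) (hx : BalancedAt ν x) : y = x := by
  by_contra hne
  have hne' : (y : E3) ≠ x := fun h => hne (Subtype.ext h)
  have hy1 : ‖(y : E3)‖ < 1 := mem_ball_zero_iff.1 y.2
  have hx1 : ‖(x : E3)‖ < 1 := mem_ball_zero_iff.1 x.2
  rw [balancedAt_iff] at hy hx
  set C := coshDist y x with hC
  set w := ratioVec (y : E3) x with hw
  have hC1 : 1 < C := one_lt_coshDist hy1 hx1 hne'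
  have hwC : ‖w‖ ^ 2 = C ^ 2 - 1 := norm_ratioVec_sq hy1 hx1
  have hw0 : w ≠ 0 := by
    intro h
    rw [h, norm_zero] at hwC
    nlinarith
  let q : S2 → ℝ := fun ζ => busemannExp x ζ / busemannExp y ζ
  let q' : S2 → ℝ := fun ζ => busemannExp y ζ / busemannExp x ζ
  have hqi : Integrable q ν := integrable_busemannExp_div ν hy1 hx1
  have hqi' : Integrable q' ν := integrable_busemannExp_div ν hx1 hy1
  have h1 : ∫ ζ, q ζ ∂ν = C := by
    have := integral_busemannExp_div ν hy1 hx1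
    rwa [hy, inner_zero_right, add_zero] at this
  have h2 : ∫ ζ, q' ζ ∂ν = C := by
    have := integral_busemannExp_div ν hx1 hy1
    rwa [hx, inner_zero_right, add_zero, coshDist_comm] at this
  have hq : ∀ ζ : S2, q ζ = C + inner ℝ w (mobius (-(y : E3)) ζ) := fun ζ =>
    busemannExp_div hy1 hx1 (by simp)
  have hq0 : ∀ ζ, 0 < q ζ := fun ζ =>
    div_pos (busemannExp_pos hx1 (by simp)) (busemannExp_pos hy1 (by simp))
  have hqq : ∀ ζ, q' ζ = (q ζ)⁻¹ := fun ζ => (inv_div _ _).symm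
  have hid : ∀ ζ, q ζ * (2 * C - q ζ - q' ζ)
      = ‖w‖ ^ 2 - inner ℝ w (mobius (-(y : E3)) ζ) ^ 2 := by
    intro ζ
    have e : q ζ * q' ζ = 1 := by rw [hqq, mul_inv_cancel₀ (hq0 ζ).ne']
    have e2 := hq ζ
    rw [hwC]
    have : inner ℝ w (mobius (-(y : E3)) ζ) = q ζ - C := by linarith
    rw [this]
    linear_combination -e
  have hcs : ∀ ζ : S2, |inner ℝ w (mobius (-(y : E3)) ζ)| ≤ ‖w‖ := by
    intro ζ
    have := abs_real_inner_le_norm w (mobius (-(y : E3)) ζ)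
    rwa [norm_mobius_neg hy1 (by simp), mul_one] at this
  have hnn : ∀ ζ, 0 ≤ 2 * C - q ζ - q' ζ := by
    intro ζ
    have h3 : 0 ≤ q ζ * (2 * C - q ζ - q' ζ) := by
      rw [hid, sub_nonneg, ← sq_abs]
      exact pow_le_pow_left₀ (abs_nonneg _) (hcs ζ) 2
    exact nonneg_of_mul_nonneg_right h3 (hq0 ζ)
  have hae : (fun ζ => 2 * C - q ζ - q' ζ) =ᵐ[ν] 0 := by
    refine (integral_eq_zero_iff_of_nonneg hnn
      (((integrable_const _).sub hqi).sub hqi')).1 ?_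
    have e1 := integral_sub ((integrable_const (2 * C)).sub hqi) hqi'
    have e2 := integral_sub (integrable_const (μ := ν) (2 * C)) hqi
    simp only [Pi.sub_apply] at e1
    rw [e1, e2, h1, h2]
    simp
    ring
  -- The equality case of Cauchy–Schwarz: the image of ζ must be one of the two unit vectors
  -- parallel to `w`.
  let S : Set S2 := {ζ | mobius (-(y : E3)) ζ = ‖w‖⁻¹ • w ∨ mobius (-(y : E3)) ζ = -(‖w‖⁻¹ • w)}
  have hsub : ∀ v : E3, {ζ : S2 | mobius (-(y : E3)) ζ = v}.Subsingleton := by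
    intro v a ha b hb
    exact Subtype.ext (mobius_neg_injOn hy1 (by simp) (by simp)
      (Set.mem_ofPred.1 ha |>.trans (Set.mem_ofPred.1 hb).symm))
  have hz : ∀ s : Set S2, s.Subsingleton → ν s = 0 := by
    intro s hs
    rcases hs.eq_empty_or_singleton with rfl | ⟨c, rfl⟩
    · simp
    · exact hν c
  have hS0 : ν S = 0 := measure_union_null (hz _ (hsub _)) (hz _ (hsub _))
  have hS : ∀ᵐ ζ ∂ν, ζ ∈ S := by
    filter_upwards [hae] with ζ hζ
    have e := hid ζ
    rw [show 2 * C - q ζ - q' ζ = 0 from hζ, mul_zero] at e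
    have e' : inner ℝ w (mobius (-(y : E3)) ζ) ^ 2 = ‖w‖ ^ 2 := by linarith
    have hm : ‖mobius (-(y : E3)) ζ‖ = 1 := norm_mobius_neg hy1 (by simp)
    have hwn : ‖w‖ ≠ 0 := norm_ne_zero_iff.2 hw0
    rcases sq_eq_sq_iff_eq_or_eq_neg.1 e' with h | h
    · left
      have := (inner_eq_norm_mul_iff_real (x := w) (y := mobius (-(y : E3)) ζ)).1
        (by rw [h, hm, mul_one])
      rw [hm, one_smul] at this
      nth_rw 2 [this]
      rw [smul_smul, inv_mul_cancel₀ hwn, one_smul]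
    · right
      have := (inner_eq_norm_mul_iff_real (x := w) (y := -mobius (-(y : E3)) ζ)).1
        (by rw [inner_neg_right, h, norm_neg, hm, mul_one, neg_neg])
      rw [norm_neg, hm, one_smul, smul_neg] at this
      nth_rw 2 [this]
      rw [smul_neg, smul_smul, inv_mul_cancel₀ hwn, one_smul, neg_neg]
  have : ν Set.univ = 0 := by
    have h3 : ν Sᶜ = 0 := hS
    rw [← Set.union_compl_self S]
    exact measure_union_null hS0 h3
  simp at this

/-- Dominated convergence with bound 1. It covers limits `y₀` inside the ball and on the sphere
alike, provided `g₀` avoids `y₀` almost everywhere. -/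
theorem tendsto_integral_mobius_neg {α : Type*} [MeasurableSpace α] {μ : Measure α}
    [IsProbabilityMeasure μ] {y : ℕ → E3} {y₀ : E3} {g : ℕ → α → E3} {g₀ : α → E3}
    (hy : ∀ n, ‖y n‖ < 1) (hg : ∀ n, Measurable (g n)) (hg1 : ∀ n a, ‖g n a‖ = 1)
    (hlim : Tendsto y atTop (𝓝 y₀))
    (hglim : ∀ᵐ a ∂μ, Tendsto (fun n => g n a) atTop (𝓝 (g₀ a)) ∧ g₀ a ≠ y₀) :
    Tendsto (fun n => ∫ a, mobius (-(y n)) (g n a) ∂μ) atTop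
      (𝓝 (∫ a, mobius (-y₀) (g₀ a) ∂μ)) := by
  refine tendsto_integral_of_dominated_convergence (fun _ => (1 : ℝ)) (fun n => ?_)
    (integrable_const _) (fun n => Eventually.of_forall fun a => ?_) ?_
  · have hm : Measurable fun a => (⟨g n a, by simpa using hg1 n a⟩ : S2) := (hg n).subtype_mk
    exact ((continuous_mobius_neg (hy n)).measurable.comp hm).aestronglyMeasurable
  · rw [norm_mobius_neg (hy n) (hg1 n a)]
  · filter_upwards [hglim] with a ha
    have h1 : ‖g₀ a‖ = 1 :=
      tendsto_nhds_unique ha.1.norm (by simp only [hg1]; exact tendsto_const_nhds)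
    have h2 : Tendsto (fun p : E3 × E3 => mobius (-p.1) p.2) (𝓝 (y₀, g₀ a))
        (𝓝 (mobius (-y₀) (g₀ a))) := (continuousAt_mobius_neg h1 ha.2).tendsto
    have h3 : Tendsto (fun n => (y n, g n a)) atTop (𝓝 (y₀, g₀ a)) := hlim.prodMk_nhds ha.1
    simpa only [Function.comp_def] using h2.comp h3

theorem mobius_neg_of_norm_eq_one {y z : E3} (hy : ‖y‖ = 1) (hz : ‖z‖ = 1) (h : z ≠ y) :
    mobius (-y) z = -y := by
  have : ‖z - y‖ ^ 2 ≠ 0 := by simpa [sub_eq_zero] using h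
  rw [mobius_neg hz this, hy]
  simp

/-! ### Existence of a balanced point by minimization -/

/-- The integrated Busemann function of a measure on the sphere. -/
def busemannIntegral (ν : Measure S2) (y : E3) : ℝ := ∫ ζ : S2, Real.log (busemannExp y ζ) ∂ν

theorem continuous_log_busemannExp {y : E3} (hy : ‖y‖ < 1) :
    Continuous fun ζ : S2 => Real.log (busemannExp y ζ) := by
  refine Continuous.log ?_ fun ζ => (busemannExp_pos hy (by simp)).ne'
  unfold busemannExp
  fun_prop

theorem continuousOn_busemannIntegral (ν : Measure S2) [IsProbabilityMeasure ν] {r : ℝ}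
    (hr : r < 1) : ContinuousOn (busemannIntegral ν) (Metric.closedBall 0 r) := by
  rw [continuousOn_iff_continuous_domRestrict]
  have hb : ∀ y : Metric.closedBall (0 : E3) r, ‖(y : E3)‖ < 1 := fun y =>
    (mem_closedBall_zero_iff.1 y.2).trans_lt hr
  have h : Continuous (Function.uncurry fun (y : Metric.closedBall (0 : E3) r) (ζ : S2) =>
      Real.log (busemannExp y ζ)) := by
    refine Continuous.log ?_ fun p => (busemannExp_pos (hb p.1) (by simp)).ne'
    unfold busemannExp
    exact Continuous.div (by fun_prop) (by fun_prop) fun p => (one_sub_norm_sq_pos (hb p.1)).ne'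
  have : LocallyCompactSpace (Metric.closedBall (0 : E3) r) :=
    Metric.isClosed_closedBall.isClosedEmbedding_subtypeVal.locallyCompactSpace
  have := continuous_parametric_integral_of_continuous (μ := ν) h isCompact_univ
  simp only [Measure.restrict_univ] at this
  exact this

/-- The inequality log t ≤ t - 1, applied to the ratio of exponentials, replaces differentiation
under the integral. -/
theorem busemannIntegral_sub_le (ν : Measure S2) [IsProbabilityMeasure ν] {y x : E3}
    (hy : ‖y‖ < 1) (hx : ‖x‖ < 1) :
    busemannIntegral ν x - busemannIntegral ν y ≤ coshDist y x - 1
      + inner ℝ (ratioVec y x) (∫ ζ : S2, mobius (-y) ζ ∂ν) := by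
  have hix := integrable_of_continuous ν (continuous_log_busemannExp hx)
  have hiy := integrable_of_continuous ν (continuous_log_busemannExp hy)
  have hid := integrable_busemannExp_div ν hy hx
  rw [busemannIntegral, busemannIntegral, ← integral_sub hix hiy]
  calc ∫ ζ : S2, (Real.log (busemannExp x ζ) - Real.log (busemannExp y ζ)) ∂ν
      ≤ ∫ ζ : S2, (busemannExp x ζ / busemannExp y ζ - 1) ∂ν := by
        refine integral_mono (hix.sub hiy) (hid.sub (integrable_const 1)) fun ζ => ?_
        have h1 := busemannExp_pos hx (z := (ζ : E3)) (by simp)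
        have h2 := busemannExp_pos hy (z := (ζ : E3)) (by simp)
        simp only
        rw [← Real.log_div h1.ne' h2.ne']
        exact Real.log_le_sub_one_of_pos (div_pos h1 h2)
    _ = _ := by
        rw [integral_sub hid (integrable_const 1), integral_busemannExp_div ν hy hx]
        simp
        ring

theorem inner_le_of_busemannIntegral_le (ν : Measure S2) [IsProbabilityMeasure ν] {y x : E3}
    (hy : ‖y‖ < 1) (hx : ‖x‖ < 1) (h : busemannIntegral ν y ≤ busemannIntegral ν x) :
    inner ℝ (x - y) (∫ ζ : S2, mobius (-y) ζ ∂ν) ≤ ‖x - y‖ ^ 2 *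
      ((1 + inner ℝ y (∫ ζ : S2, mobius (-y) ζ ∂ν)) / (1 - ‖y‖ ^ 2)) := by
  have h1 := busemannIntegral_sub_le ν hy hx
  have ha := one_sub_norm_sq_pos hy
  have hb := one_sub_norm_sq_pos hx
  set m := ∫ ζ : S2, mobius (-y) ζ ∂ν
  -- Once the positive factor is removed, the error is quadratic in `x - y` with a coefficient
  -- independent of `x`.
  have e : coshDist y x - 1 + inner ℝ (ratioVec y x) m = 2 / (1 - ‖x‖ ^ 2) *
      (‖x - y‖ ^ 2 * ((1 + inner ℝ y m) / (1 - ‖y‖ ^ 2)) - inner ℝ (x - y) m) := by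
    rw [coshDist, ratioVec, norm_sub_rev y x]
    simp only [inner_smul_left, inner_add_left, inner_sub_left, RCLike.conj_to_real]
    field_simp
    ring
  have h2 : 0 ≤ 2 / (1 - ‖x‖ ^ 2) *
      (‖x - y‖ ^ 2 * ((1 + inner ℝ y m) / (1 - ‖y‖ ^ 2)) - inner ℝ (x - y) m) := by
    rw [← e]; linarith
  have := nonneg_of_mul_nonneg_right h2 (by positivity)
  linarith

/-- The one-sided first-order condition: the balance integral acts as a descent direction. Only
small positive times are needed, so it applies at boundary minimizers. -/
theorem inner_nonpos_of_isMinOn (ν : Measure S2) [IsProbabilityMeasure ν] {r : ℝ} (hr : r < 1)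
    {y v : E3} (hy : ‖y‖ ≤ r) (hmin : IsMinOn (busemannIntegral ν) (Metric.closedBall 0 r) y)
    (hv : ∀ᶠ t : ℝ in 𝓝[>] 0, ‖y + t • v‖ ≤ r) :
    inner ℝ v (∫ ζ : S2, mobius (-y) ζ ∂ν) ≤ 0 := by
  set m := ∫ ζ : S2, mobius (-y) ζ ∂ν with hm
  set K := ‖v‖ ^ 2 * ((1 + inner ℝ y m) / (1 - ‖y‖ ^ 2)) with hK
  have hlim : Tendsto (fun t : ℝ => t * K) (𝓝[>] 0) (𝓝 0) := by
    have : Tendsto (fun t : ℝ => t * K) (𝓝 0) (𝓝 (0 * K)) :=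
      (continuous_id.mul continuous_const).tendsto 0
    rw [zero_mul] at this
    exact this.mono_left nhdsWithin_le_nhds
  refine ge_of_tendsto hlim ?_
  filter_upwards [hv, self_mem_nhdsWithin] with t ht ht0
  have ht0 : 0 < t := ht0
  have h := inner_le_of_busemannIntegral_le ν (hy.trans_lt hr) (ht.trans_lt hr)
    (hmin (mem_closedBall_zero_iff.2 ht))
  rw [add_sub_cancel_left, inner_smul_left, norm_smul, mul_pow, Real.norm_eq_abs, sq_abs,
    RCLike.conj_to_real, ← hm] at h
  have h' : t * inner ℝ v m ≤ t * (t * K) := by rw [hK]; linarith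
  exact le_of_mul_le_mul_left h' ht0

theorem exists_balancedAt {ν : Measure S2} [IsProbabilityMeasure ν] (hν : ∀ c, ν {c} = 0) :
    ∃ y, BalancedAt ν y := by
  by_contra! hno
  have key : ∀ n : ℕ, ∃ y : E3, ‖y‖ = 1 - 1 / ((n : ℝ) + 2) ∧
      inner ℝ (-y) (∫ ζ : S2, mobius (-y) ζ ∂ν) ≤ 0 := by
    intro n
    have hn : (0 : ℝ) < 1 / ((n : ℝ) + 2) := by positivity
    have hn1 : 1 / ((n : ℝ) + 2) ≤ 1 := by
      rw [div_le_one (by positivity)]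
      have : (0 : ℝ) ≤ n := n.cast_nonneg
      linarith
    set r : ℝ := 1 - 1 / ((n : ℝ) + 2)
    have hr1 : r < 1 := sub_lt_self _ hn
    obtain ⟨y, hy, hmin⟩ := (isCompact_closedBall (0 : E3) r).exists_isMinOn
      ⟨0, mem_closedBall_zero_iff.2 (by rw [norm_zero]; exact sub_nonneg.2 hn1)⟩ (continuousOn_busemannIntegral ν hr1)
    have hyr : ‖y‖ ≤ r := mem_closedBall_zero_iff.1 hy
    refine ⟨y, hyr.antisymm ?_, inner_nonpos_of_isMinOn ν hr1 hyr hmin ?_⟩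
    · by_contra! hlt
      have h0 := inner_nonpos_of_isMinOn ν hr1 hyr hmin
        -- An interior minimizer allows every direction; the balance integral itself, tested as
        -- direction, must then vanish.
        (v := ∫ ζ : S2, mobius (-y) ζ ∂ν) ?_
      · rw [real_inner_self_eq_norm_sq] at h0
        have h1 : ∫ ζ : S2, mobius (-y) ζ ∂ν = 0 :=
          norm_eq_zero.1 (pow_eq_zero_iff two_ne_zero |>.1 (le_antisymm h0 (sq_nonneg _)))
        exact hno ⟨y, mem_ball_zero_iff.2 (hyr.trans_lt hr1)⟩ ((balancedAt_iff _ _).2 h1)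
      · have hc : Continuous fun t : ℝ => ‖y + t • ∫ ζ : S2, mobius (-y) ζ ∂ν‖ := by fun_prop
        have := hc.tendsto 0
        simp only [zero_smul, add_zero] at this
        exact ((this.eventually_lt_const hlt).mono fun _ h => h.le).filter_mono
          nhdsWithin_le_nhds
    · have h1 : ∀ᶠ t : ℝ in 𝓝[>] 0, t ∈ Set.Ioo (0 : ℝ) 1 := Ioo_mem_nhdsGT one_pos
      filter_upwards [h1] with t ht
      have : y + t • -y = (1 - t) • y := by module
      rw [this, norm_smul, Real.norm_eq_abs, abs_of_pos (by linarith [ht.2])]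
      nlinarith [ht.1, norm_nonneg y]
  choose y hy1 hy2 using key
  have hylt : ∀ n, ‖y n‖ < 1 := by
    intro n
    rw [hy1]
    have : (0 : ℝ) < 1 / ((n : ℝ) + 2) := by positivity
    linarith
  have hnorm : Tendsto (fun n => ‖y n‖) atTop (𝓝 1) := by
    simp only [hy1]
    have : Tendsto (fun n : ℕ => 1 / ((n : ℝ) + 2)) atTop (𝓝 0) :=
      tendsto_const_nhds.div_atTop
        (tendsto_atTop_add_const_right _ _ tendsto_natCast_atTop_atTop)
    simpa using this.const_sub 1
  obtain ⟨ξ, -, φ, hφ, hξ⟩ := (isCompact_closedBall (0 : E3) 1).tendsto_subseq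
    (x := y) fun n => mem_closedBall_zero_iff.2 (hylt n).le
  have hξ1 : ‖ξ‖ = 1 := tendsto_nhds_unique hξ.norm (hnorm.comp hφ.tendsto_atTop)
  have hae : ∀ᵐ ζ : S2 ∂ν, (ζ : E3) ≠ ξ := by
    have := hν ⟨ξ, by simpa using hξ1⟩
    refine measure_mono_null (fun ζ hζ => ?_) this
    exact Subtype.ext (not_not.1 hζ)
  have hlim := tendsto_integral_mobius_neg (μ := ν) (y := fun n => y (φ n)) (y₀ := ξ)
    (g := fun _ ζ => (ζ : E3)) (g₀ := fun ζ => (ζ : E3)) (fun n => hylt _)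
    (fun _ => measurable_subtype_coe) (fun _ _ => by simp) hξ
    (hae.mono fun ζ hζ => ⟨tendsto_const_nhds, hζ⟩)
  have e : ∫ ζ : S2, mobius (-ξ) ζ ∂ν = -ξ := by
    rw [integral_congr_ae (hae.mono fun ζ hζ => mobius_neg_of_norm_eq_one hξ1 (by simp) hζ)]
    simp
  rw [e] at hlim
  -- The inner products are nonpositive, yet they tend to `‖-ξ‖ ^ 2 = 1`.
  have h3 := hξ.neg.inner (𝕜 := ℝ) hlim
  have h4 := le_of_tendsto h3 (Eventually.of_forall fun n => hy2 (φ n))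
  rw [real_inner_self_eq_norm_sq, norm_neg, hξ1] at h4
  norm_num at h4

theorem existsUnique_balancedAt {ν : Measure S2} [IsProbabilityMeasure ν]
    (hν : ∀ c, ν {c} = 0) : ∃! y, BalancedAt ν y := by
  obtain ⟨y, hy⟩ := exists_balancedAt hν
  exact ⟨y, hy, fun x hx => balancedAt_unique hν hx hy⟩

/-! ### The rotation-invariant measure -/

instance isProbabilityMeasure_sphereMeasure : IsProbabilityMeasure sphereMeasure := by
  refine ⟨?_⟩
  have h0 : (volume : Measure E3).toSphere Set.univ ≠ 0 := by
    rw [Measure.measure_univ_ne_zero]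
    exact Measure.toSphere_ne_zero _
  rw [sphereMeasure, Measure.smul_apply, smul_eq_mul,
    ENNReal.inv_mul_cancel h0 (measure_ne_top _ _)]

/-- The cone over a point lies in a line, which is null in three dimensions. -/
theorem toSphere_singleton (c : S2) : (volume : Measure E3).toSphere {c} = 0 := by
  rw [Measure.toSphere_apply' _ (measurableSet_singleton c)]
  have hne : Submodule.span ℝ {(c : E3)} ≠ ⊤ := by
    intro h
    have h1 := finrank_span_singleton (K := ℝ) (v := (c : E3)) (by
      intro h0
      have : ‖(c : E3)‖ = 1 := by simp
      rw [h0, norm_zero] at this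
      norm_num at this)
    rw [h, finrank_top] at h1
    simp at h1
  have h0 := Measure.addHaar_submodule (volume : Measure E3) _ hne
  rw [measure_mono_null ?_ h0, mul_zero]
  rw [Set.image_singleton]
  rintro _ ⟨t, -, _, rfl, rfl⟩
  exact Submodule.smul_mem _ _ (Submodule.mem_span_singleton_self _)

theorem sphereMeasure_finite {s : Set S2} (hs : s.Finite) : sphereMeasure s = 0 := by
  rw [← Set.biUnion_of_singleton s, measure_biUnion_null_iff hs.countable]
  intro c _
  rw [sphereMeasure, Measure.smul_apply, toSphere_singleton, smul_zero]

/-! ### Stereographic coordinates -/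

open Classical in
/-- Homogeneous coordinates of a point of the sphere. -/
def sphereVec (ζ : S2) : Fin 2 → ℂ :=
  if (ζ : E3) 2 = 1 then ![1, 0] else ![⟨(ζ : E3) 0, (ζ : E3) 1⟩, ((1 - (ζ : E3) 2 : ℝ) : ℂ)]

theorem sphereVec_ne_zero (ζ : S2) : sphereVec ζ ≠ 0 := by
  intro h
  unfold sphereVec at h
  split_ifs at h with h1
  · simpa using congrFun h 0
  · have := congrFun h 1
    simp only [Matrix.cons_val_one, Matrix.cons_val_zero, Pi.zero_apply,
      Complex.ofReal_eq_zero] at this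
    exact h1 (by linarith)

theorem ofS2_eq_mk (ζ : S2) :
    ofS2 ζ = Projectivization.mk ℂ (sphereVec ζ) (sphereVec_ne_zero ζ) := by
  unfold ofS2
  split_ifs with h
  · simp [sphereVec, h]
  · simp [sphereVec, h]

theorem toS2_mk (v : Fin 2 → ℂ) (hv : v ≠ 0) :
    (toS2 (Projectivization.mk ℂ v hv) : E3) = stereoVec v := by
  rw [toS2, Projectivization.lift_mk]

theorem stereoVec_sphereVec (ζ : S2) : stereoVec (sphereVec ζ) = ζ := by
  rw [← toS2_mk _ (sphereVec_ne_zero ζ), ← ofS2_eq_mk, toS2_ofS2]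

theorem exists_smul_eq_of_stereoVec_eq {u v : Fin 2 → ℂ} (hu : u ≠ 0) (hv : v ≠ 0)
    (h : stereoVec u = stereoVec v) : ∃ t : ℂ, t • v = u := by
  rw [← Projectivization.mk_eq_mk_iff' ℂ u v hu hv]
  apply riemannSphere.injective
  apply Subtype.ext
  change (toS2 _ : E3) = toS2 _
  rw [toS2_mk, toS2_mk, h]

theorem continuousAt_stereoVec {v : Fin 2 → ℂ} (hv : v ≠ 0) : ContinuousAt stereoVec v := by
  have h1 : Continuous fun v : Fin 2 → ℂ => Complex.normSq (v 0) + Complex.normSq (v 1) :=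
    (Complex.continuous_normSq.comp (continuous_apply 0)).add
      (Complex.continuous_normSq.comp (continuous_apply 1))
  have h2 : Continuous fun v : Fin 2 → ℂ =>
      !₂[2 * (v 0 * (starRingEnd ℂ) (v 1)).re, 2 * (v 0 * (starRingEnd ℂ) (v 1)).im,
      Complex.normSq (v 0) - Complex.normSq (v 1)] := by
    refine (PiLp.continuous_toLp 2 _).comp (continuous_pi fun i => ?_)
    have hn : Continuous Complex.normSq := Complex.continuous_normSq
    fin_cases i
    · change Continuous fun v : Fin 2 → ℂ => 2 * (v 0 * (starRingEnd ℂ) (v 1)).re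
      fun_prop
    · change Continuous fun v : Fin 2 → ℂ => 2 * (v 0 * (starRingEnd ℂ) (v 1)).im
      fun_prop
    · change Continuous fun v : Fin 2 → ℂ => Complex.normSq (v 0) - Complex.normSq (v 1)
      exact (hn.comp (continuous_apply 0)).sub (hn.comp (continuous_apply 1))
  have h3 := (h1.continuousAt (x := v)).inv₀ (normSq_add_pos hv).ne'
  exact h3.smul (h2.continuousAt (x := v))

theorem measurable_stereoVec : Measurable stereoVec := by
  refine measurable_of_continuousOn_compl_singleton 0 fun v hv => ?_
  exact (continuousAt_stereoVec hv).continuousWithinAt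

theorem measurable_sphereVec : Measurable sphereVec := by
  have hc : ∀ i, Measurable fun ζ : S2 => (ζ : E3) i := fun i => by fun_prop
  unfold sphereVec
  refine Measurable.ite ((hc 2) (measurableSet_singleton 1)) measurable_const ?_
  refine measurable_pi_iff.2 fun i => ?_
  fin_cases i
  · change Measurable fun ζ : S2 => (⟨(ζ : E3) 0, (ζ : E3) 1⟩ : ℂ)
    exact Complex.measurableEquivRealProd.symm.measurable.comp ((hc 0).prodMk (hc 1))
  · change Measurable fun ζ : S2 => ((1 - (ζ : E3) 2 : ℝ) : ℂ)
    exact Complex.measurable_ofReal.comp ((hc 2).const_sub 1)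

/-! ### Values of forms -/

/-- The values at `v` of a pair of forms. -/
def evalPair {d : ℕ} (a : Fin 2 → Fin (d + 1) → ℂ) (v : Fin 2 → ℂ) : Fin 2 → ℂ :=
  fun j => MvPolynomial.eval v (form (a j))

theorem evalPair_smul {d : ℕ} (t : ℂ) (a : Fin 2 → Fin (d + 1) → ℂ) (v : Fin 2 → ℂ) :
    evalPair (t • a) v = t • evalPair a v := by
  ext j
  simp only [evalPair, eval_form, Pi.smul_apply, smul_eq_mul, Finset.mul_sum, mul_assoc]

theorem continuous_evalPair {d : ℕ} : Continuous
    fun p : (Fin 2 → Fin (d + 1) → ℂ) × (Fin 2 → ℂ) => evalPair p.1 p.2 := by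
  refine continuous_pi fun j => ?_
  simp only [evalPair, eval_form]
  fun_prop

/-- Away from the north pole, dehomogenizing gives a nonzero one-variable polynomial with the same
coefficients. -/
theorem finite_zeros {d : ℕ} {a : Fin (d + 1) → ℂ} (ha : a ≠ 0) :
    {ζ : S2 | MvPolynomial.eval (sphereVec ζ) (form a) = 0}.Finite := by
  let p : Polynomial ℂ := ∑ i : Fin (d + 1), Polynomial.monomial (i : ℕ) (a i)
  have hcoef : ∀ i : Fin (d + 1), p.coeff i = a i := by
    intro i
    simp [p, Polynomial.coeff_monomial, Fin.val_inj]
  have hp : p ≠ 0 := by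
    rintro h
    apply ha
    ext i
    rw [← hcoef, h]
    simp
  have hpe : ∀ (t x : ℂ), MvPolynomial.eval (t • ![x, 1]) (form a) = t ^ d * p.eval x := by
    intro t x
    rw [eval_form_smul, eval_form]
    simp [p, Polynomial.eval_finsetSum, Polynomial.eval_monomial]
  refine Set.Finite.of_finite_image (f := (Subtype.val : S2 → E3)) ?_
    Subtype.val_injective.injOn
  refine Set.Finite.subset ((Set.finite_singleton (stereoVec ![1, 0])).union
    (((Polynomial.rootSet_finite p ℂ)).image fun x => stereoVec ![x, 1])) ?_
  rintro _ ⟨ζ, hζ, rfl⟩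
  by_cases h : (ζ : E3) 2 = 1
  · left
    rw [Set.mem_singleton_iff, ← stereoVec_sphereVec ζ, sphereVec, if_pos h]
  · right
    have ht : ((1 - (ζ : E3) 2 : ℝ) : ℂ) ≠ 0 := by
      rw [Complex.ofReal_ne_zero]
      exact fun h' => h (by linarith)
    have e : sphereVec ζ = ((1 - (ζ : E3) 2 : ℝ) : ℂ) •
        ![(⟨(ζ : E3) 0, (ζ : E3) 1⟩ : ℂ) / ((1 - (ζ : E3) 2 : ℝ) : ℂ), 1] := by
      rw [sphereVec, if_neg h]
      ext i
      fin_cases i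
      · simp only [Fin.zero_eta, Matrix.cons_val_zero, Pi.smul_apply, smul_eq_mul]
        rw [mul_div_cancel₀ _ ht]
      · simp
    refine ⟨_, ?_, (stereoVec_smul _ ht).symm.trans ((congrArg stereoVec e.symm).trans
      (stereoVec_sphereVec ζ))⟩
    rw [Set.mem_ofPred, e, hpe] at hζ
    rw [Polynomial.mem_rootSet]
    refine ⟨hp, ?_⟩
    simpa using (mul_eq_zero.1 hζ).resolve_left (pow_ne_zero _ ht)

theorem ae_eval_form_ne_zero {d : ℕ} {a : Fin (d + 1) → ℂ} (ha : a ≠ 0) :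
    ∀ᵐ ζ ∂sphereMeasure, MvPolynomial.eval (sphereVec ζ) (form a) ≠ 0 := by
  rw [ae_iff]
  simpa only [ne_eq, not_not] using sphereMeasure_finite (finite_zeros ha)

theorem ae_evalPair_ne_zero {d : ℕ} {a : Fin 2 → Fin (d + 1) → ℂ} (ha : a ≠ 0) :
    ∀ᵐ ζ ∂sphereMeasure, evalPair a (sphereVec ζ) ≠ 0 := by
  obtain ⟨j, hj⟩ := Function.ne_iff.1 ha
  filter_upwards [ae_eval_form_ne_zero hj] with ζ hζ h
  exact hζ (congrFun h j)

/-- The value at `ζ` of the rational map `φ_F`, and `0` at the common zeros. -/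
def sphereValue {d : ℕ} (F : RatBar d) (ζ : S2) : E3 := stereoVec (evalPair F.rep (sphereVec ζ))

theorem measurable_sphereValue {d : ℕ} (F : RatBar d) : Measurable (sphereValue F) :=
  measurable_stereoVec.comp ((continuous_evalPair.comp
    (Continuous.prodMk_right F.rep)).measurable.comp measurable_sphereVec)

theorem coe_sphereMap {d : ℕ} (F : Rat d) (ζ : S2) :
    (sphereMap F ζ : E3) = sphereValue F.1 ζ := by
  change (toS2 (ratMap F (ofS2 ζ)) : E3) = _
  rw [ofS2_eq_mk, ratMap, Projectivization.lift_mk, toS2_mk]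
  rfl

theorem norm_sphereValue {d : ℕ} (F : Rat d) (ζ : S2) : ‖sphereValue F.1 ζ‖ = 1 := by
  rw [← coe_sphereMap]
  simp

theorem measurable_sphereMap {d : ℕ} (F : Rat d) : Measurable (sphereMap F) := by
  have : Measurable fun ζ => (sphereMap F ζ : E3) := by
    simp only [coe_sphereMap]
    exact measurable_sphereValue F.1
  exact this.subtype_mk (h := fun ζ => (sphereMap F ζ).2)

theorem sphereValue_mk {d : ℕ} (a : Fin 2 → Fin (d + 1) → ℂ) (ha : a ≠ 0) (ζ : S2) :
    sphereValue (Projectivization.mk ℂ a ha) ζ = stereoVec (evalPair a (sphereVec ζ)) := by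
  obtain ⟨t, ht⟩ := Projectivization.exists_smul_eq_mk_rep ℂ a ha
  rw [sphereValue, ← ht, Units.smul_def, evalPair_smul, stereoVec_smul _ t.ne_zero]

/-! ### Degree zero -/

theorem hasDegree_zero_of_smul_eq {d : ℕ} {F : RatBar d} {α : Fin 2 → ℂ} (hα : α ≠ 0)
    (h : α 1 • F.rep 0 = α 0 • F.rep 1) : HasDegree F 0 := by
  have hform : ∀ (t : ℂ) (a : Fin (d + 1) → ℂ), form (t • a) = MvPolynomial.C t * form a := by
    intro t a
    simp [form, Finset.mul_sum, mul_assoc]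
  have hC : ∀ t : ℂ, (MvPolynomial.C t : MvPolynomial (Fin 2) ℂ).IsHomogeneous 0 :=
    fun t => MvPolynomial.isHomogeneous_C _ t
  by_cases h0 : α 0 = 0
  · have h1 : α 1 ≠ 0 := by
      intro h1
      apply hα
      ext i
      fin_cases i <;> simp [h0, h1]
    rw [h0, zero_smul, smul_eq_zero_iff_right h1] at h
    refine ⟨poly F 1, MvPolynomial.C 0, MvPolynomial.C 1, hC _, hC _, ?_, ?_, ?_⟩
    · rw [map_one]; exact isRelPrime_one_right
    · simp [poly, h, form]
    · simp
  · refine ⟨poly F 0, MvPolynomial.C 1, MvPolynomial.C (α 1 / α 0), hC _, hC _, ?_, ?_, ?_⟩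
    · rw [map_one]; exact isRelPrime_one_left
    · simp
    · have : F.rep 1 = (α 1 / α 0) • F.rep 0 := by
        rw [div_eq_inv_mul, mul_smul, h, inv_smul_smul₀ h0]
      rw [poly, poly, this, hform, mul_comm]

/-- With `c = (α 0 : α 1)`, the fibre over `c` lies in the zeros of `α 1 P - α 0 Q`, a form that
vanishes identically only if F has degree 0. Common zeros of P and Q are discarded as a null set. -/
theorem ae_sphereValue_ne {d : ℕ} {F : RatBar d} (hF : ¬ HasDegree F 0) (c : E3)
    (hc : ‖c‖ = 1) : ∀ᵐ ζ ∂sphereMeasure, sphereValue F ζ ≠ c := by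
  obtain ⟨c, rfl⟩ : ∃ c' : S2, (c' : E3) = c := ⟨⟨c, by simpa using hc⟩, rfl⟩
  set α := sphereVec c
  have hne : α 1 • F.rep 0 - α 0 • F.rep 1 ≠ 0 := fun h =>
    hF (hasDegree_zero_of_smul_eq (sphereVec_ne_zero c) (sub_eq_zero.1 h))
  filter_upwards [ae_eval_form_ne_zero hne, ae_evalPair_ne_zero F.rep_nonzero] with ζ h1 h2 h
  obtain ⟨t, ht⟩ := exists_smul_eq_of_stereoVec_eq h2 (sphereVec_ne_zero c)
    (h.trans (stereoVec_sphereVec c).symm)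
  apply h1
  have e : MvPolynomial.eval (sphereVec ζ) (form (α 1 • F.rep 0 - α 0 • F.rep 1))
      = α 1 * evalPair F.rep (sphereVec ζ) 0 - α 0 * evalPair F.rep (sphereVec ζ) 1 := by
    simp only [evalPair, eval_form, Finset.mul_sum, ← Finset.sum_sub_distrib]
    refine Finset.sum_congr rfl fun i _ => ?_
    simp only [Pi.sub_apply, Pi.smul_apply, smul_eq_mul]
    ring
  rw [e, ← ht]
  simp only [Pi.smul_apply, smul_eq_mul, α]
  ring

theorem HasDegree.exists_C {d : ℕ} {F : RatBar d} (hF : HasDegree F 0) :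
    ∃ (H : MvPolynomial (Fin 2) ℂ) (α : Fin 2 → ℂ), ∀ j, poly F j = H * MvPolynomial.C (α j) := by
  obtain ⟨H, p, q, hp, hq, -, h0, h1⟩ := hF
  have hC : ∀ r : MvPolynomial (Fin 2) ℂ, r.IsHomogeneous 0 →
      r = MvPolynomial.C (MvPolynomial.coeff 0 r) := fun r hr =>
    MvPolynomial.totalDegree_eq_zero_iff_eq_C.1 (Nat.le_zero.1 hr.totalDegree_le)
  refine ⟨H, ![MvPolynomial.coeff 0 p, MvPolynomial.coeff 0 q], fun j => ?_⟩
  fin_cases j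
  · simpa [← hC p hp] using h0
  · simpa [← hC q hq] using h1

theorem HasDegree.ae_sphereValue_eq {d : ℕ} {F : RatBar d} (hF : HasDegree F 0) :
    ∃ c : E3, ‖c‖ = 1 ∧ ∀ᵐ ζ ∂sphereMeasure, sphereValue F ζ = c := by
  obtain ⟨H, α, h⟩ := hF.exists_C
  have e : ∀ v, evalPair F.rep v = MvPolynomial.eval v H • α := by
    intro v
    ext j
    change MvPolynomial.eval v (poly F j) = _
    rw [h]
    simp
  have hae := ae_evalPair_ne_zero F.rep_nonzero
  obtain ⟨ζ₀, h0⟩ := hae.exists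
  rw [e, smul_ne_zero_iff] at h0
  refine ⟨stereoVec α, norm_stereoVec h0.2, ?_⟩
  filter_upwards [hae] with ζ hζ
  rw [e, smul_ne_zero_iff] at hζ
  rw [sphereValue, e, stereoVec_smul _ hζ.1]

/-- The common factor would be a unit, hence nonzero at the origin, where forms of degree d ≥ 1
vanish; this kills both constants. -/
theorem not_hasDegree_zero {d : ℕ} (hd : 1 ≤ d) (F : Rat d) : ¬ HasDegree F.1 0 := by
  intro hF
  obtain ⟨H, α, h⟩ := hF.exists_C
  have hev : ∀ a : Fin (d + 1) → ℂ, MvPolynomial.eval 0 (form a) = 0 := by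
    intro a
    have := eval_form_smul a 0 0
    rwa [zero_smul, zero_pow (by omega), zero_mul] at this
  have hu : IsUnit H := F.2 ⟨_, h 0⟩ ⟨_, h 1⟩
  have hH : MvPolynomial.eval 0 H ≠ 0 := (hu.map (MvPolynomial.eval (0 : Fin 2 → ℂ))).ne_zero
  have hα : ∀ j, α j = 0 := by
    intro j
    have h1 := congrArg (MvPolynomial.eval (0 : Fin 2 → ℂ)) (h j)
    rw [poly, hev, map_mul, MvPolynomial.eval_C] at h1
    exact (mul_eq_zero.1 h1.symm).resolve_left hH
  refine eval_ne_zero F (v := ![1, 0]) (by simp) ?_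
  ext j
  simp [h j, hα j]

/-! ### Convergence in `RatBar` -/

theorem continuous_mk {d : ℕ} : Continuous
    fun a : {a : Fin 2 → Fin (d + 1) → ℂ // a ≠ 0} => Projectivization.mk ℂ a.1 a.2 :=
  continuous_coinduced_rng

/-- The saturation of an open set is a union of its preimages under scalings. Openness lets limits
at a point of `RatBar d` be tested on representatives. -/
theorem isOpenMap_mk {d : ℕ} : IsOpenMap
    fun a : {a : Fin 2 → Fin (d + 1) → ℂ // a ≠ 0} => Projectivization.mk ℂ a.1 a.2 := by
  intro U hU
  rw [isOpen_coinduced]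
  have e : (fun a : {a : Fin 2 → Fin (d + 1) → ℂ // a ≠ 0} => Projectivization.mk ℂ a.1 a.2) ⁻¹'
      ((fun a : {a : Fin 2 → Fin (d + 1) → ℂ // a ≠ 0} => Projectivization.mk ℂ a.1 a.2) '' U)
      = ⋃ t : ℂˣ, (fun a : {a : Fin 2 → Fin (d + 1) → ℂ // a ≠ 0} =>
        (⟨(t : ℂ) • a.1, smul_ne_zero t.ne_zero a.2⟩ :
          {a : Fin 2 → Fin (d + 1) → ℂ // a ≠ 0})) ⁻¹' U := by
    ext a
    simp only [Set.mem_preimage, Set.mem_image, Set.mem_iUnion]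
    constructor
    · rintro ⟨b, hb, hab⟩
      obtain ⟨t, ht⟩ := (Projectivization.mk_eq_mk_iff ℂ _ _ b.2 a.2).1 hab
      refine ⟨t, ?_⟩
      convert hb
      exact ht
    · rintro ⟨t, ht⟩
      exact ⟨_, ht, (Projectivization.mk_eq_mk_iff ℂ _ _ _ a.2).2 ⟨t, rfl⟩⟩
  rw [e]
  refine isOpen_iUnion fun t => hU.preimage ?_
  exact Continuous.subtype_mk (continuous_const_smul (t : ℂ) |>.comp continuous_subtype_val) _

theorem tendsto_sphereValue {d : ℕ} {F : RatBar d} {ζ : S2}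
    (h : evalPair F.rep (sphereVec ζ) ≠ 0) :
    Tendsto (fun G : RatBar d => sphereValue G ζ) (𝓝 F) (𝓝 (sphereValue F ζ)) := by
  let a₀ : {a : Fin 2 → Fin (d + 1) → ℂ // a ≠ 0} := ⟨F.rep, F.rep_nonzero⟩
  have hmap := isOpenMap_mk.nhds_le a₀
  have e : Projectivization.mk ℂ a₀.1 a₀.2 = F := F.mk_rep
  rw [e] at hmap
  refine Tendsto.mono_left ?_ hmap
  rw [tendsto_map'_iff]
  have h0 : Continuous fun a : {a : Fin 2 → Fin (d + 1) → ℂ // a ≠ 0} => (a.1, sphereVec ζ) :=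
    continuous_subtype_val.prodMk continuous_const
  have h1 := (continuous_evalPair.comp h0).tendsto a₀
  have h2 : Tendsto stereoVec (𝓝 (evalPair F.rep (sphereVec ζ))) (𝓝 (sphereValue F ζ)) :=
    (continuousAt_stereoVec h).tendsto
  exact (h2.comp h1).congr fun a => (sphereValue_mk a.1 a.2 ζ).symm

theorem ae_tendsto_sphereValue {d : ℕ} {F : RatBar d} {u : ℕ → RatBar d}
    (hu : Tendsto u atTop (𝓝 F)) : ∀ᵐ ζ ∂sphereMeasure,
      Tendsto (fun n => sphereValue (u n) ζ) atTop (𝓝 (sphereValue F ζ)) := by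
  filter_upwards [ae_evalPair_ne_zero F.rep_nonzero] with ζ hζ
  exact (tendsto_sphereValue hζ).comp hu

/-- Representatives scaled to norm 1 lie in a compact sphere. -/
theorem exists_tendsto_subseq {d : ℕ} (u : ℕ → RatBar d) :
    ∃ F, ∃ φ : ℕ → ℕ, StrictMono φ ∧ Tendsto (u ∘ φ) atTop (𝓝 F) := by
  let w : ℕ → Fin 2 → Fin (d + 1) → ℂ := fun n => ((‖(u n).rep‖⁻¹ : ℝ) : ℂ) • (u n).rep
  have hn : ∀ n, ‖(u n).rep‖ ≠ 0 := fun n => norm_ne_zero_iff.2 (u n).rep_nonzero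
  have hw : ∀ n, w n ∈ Metric.sphere (0 : Fin 2 → Fin (d + 1) → ℂ) 1 := by
    intro n
    rw [mem_sphere_zero_iff_norm, norm_smul, Complex.norm_real, norm_inv, norm_norm,
      inv_mul_cancel₀ (hn n)]
  have hs : ∀ a ∈ Metric.sphere (0 : Fin 2 → Fin (d + 1) → ℂ) 1, a ≠ 0 := by
    intro a ha h0
    rw [mem_sphere_zero_iff_norm, h0, norm_zero] at ha
    norm_num at ha
  obtain ⟨a, ha, φ, hφ, hlim⟩ := (isCompact_sphere _ _).tendsto_subseq hw
  refine ⟨Projectivization.mk ℂ a (hs a ha), φ, hφ, ?_⟩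
  have e : ∀ n, u n = Projectivization.mk ℂ (w n) (hs _ (hw n)) := by
    intro n
    conv_lhs => rw [← (u n).mk_rep]
    rw [Projectivization.mk_eq_mk_iff']
    exact ⟨(‖(u n).rep‖ : ℂ), by
      rw [smul_smul, ← Complex.ofReal_mul, mul_inv_cancel₀ (hn n), Complex.ofReal_one, one_smul]⟩
  have h1 : Tendsto (fun n => (⟨w (φ n), hs _ (hw _)⟩ :
      {a : Fin 2 → Fin (d + 1) → ℂ // a ≠ 0})) atTop (𝓝 ⟨a, hs a ha⟩) :=
    tendsto_subtype_rng.2 hlim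
  have h2 := (continuous_mk.tendsto _).comp h1
  refine h2.congr fun n => ?_
  exact (e (φ n)).symm

/-! ### Barycentric extensions of rational maps -/

theorem mobiusSphere_origin : mobiusSphere origin = id := by
  ext1 ζ
  exact Subtype.ext (mobius_zero _)

/-- The measure whose barycenter is the value of the barycentric extension at the origin. -/
abbrev pushMeasure {d : ℕ} (F : Rat d) : Measure S2 :=
  sphereMeasure.map (sphereMap F ∘ mobiusSphere origin)

theorem existsUnique_balancedAt_pushMeasure {d : ℕ} (hd : 1 ≤ d) (F : Rat d) :
    ∃! y, BalancedAt (pushMeasure F) y := by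
  have hm := measurable_sphereMap F
  rw [pushMeasure, mobiusSphere_origin, Function.comp_id]
  have := Measure.isProbabilityMeasure_map (μ := sphereMeasure) hm.aemeasurable
  refine existsUnique_balancedAt fun c => ?_
  rw [Measure.map_apply hm (measurableSet_singleton c)]
  refine measure_mono_null (fun ζ hζ => ?_)
    (ae_iff.1 (ae_sphereValue_ne (not_hasDegree_zero hd F) c (by simp)))
  rw [Set.mem_preimage, Set.mem_singleton_iff] at hζ
  rw [Set.mem_ofPred, not_not, ← coe_sphereMap, hζ]

theorem integral_mobius_barycentricExtension {d : ℕ} (hd : 1 ≤ d) (F : Rat d) :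
    ∫ ζ, mobius (-(barycentricExtension (sphereMap F) origin : E3)) (sphereValue F.1 ζ)
      ∂sphereMeasure = 0 := by
  have hu := existsUnique_balancedAt_pushMeasure hd F
  have hb : BalancedAt (pushMeasure F) (barycentricExtension (sphereMap F) origin) := by
    rw [barycentricExtension, barycenter, dif_pos hu]
    exact hu.choose_spec.1
  rw [balancedAt_iff, pushMeasure, mobiusSphere_origin, Function.comp_id,
    integral_map (measurable_sphereMap F).aemeasurable] at hb
  · simpa only [coe_sphereMap] using hb
  · exact (continuous_mobius_neg (mem_ball_zero_iff.1 (Subtype.prop _))).aestronglyMeasurable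

/-! ### Hyperbolic bounds and limits of barycenters -/

theorem hypDist_origin (y : H3) :
    hypDist origin y = 2 * Real.arsinh (‖(y : E3)‖ / √(1 - ‖(y : E3)‖ ^ 2)) := by
  simp [hypDist, origin]

theorem norm_lt_one_of_hypDist_le {y : ℕ → H3} {y₀ : E3} {R : ℝ}
    (hR : ∀ n, hypDist origin (y n) ≤ R) (hlim : Tendsto (fun n => (y n : E3)) atTop (𝓝 y₀)) :
    ‖y₀‖ < 1 := by
  -- The bound is cleared of its denominator so that it passes to the limit even if `y₀` were on the
  -- sphere, where the root is 0.
  have hle : ∀ n, ‖(y n : E3)‖ ≤ Real.sinh (R / 2) * √(1 - ‖(y n : E3)‖ ^ 2) := by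
    intro n
    have h1 := hR n
    have hpos := one_sub_norm_sq_pos (mem_ball_zero_iff.1 (y n).2)
    rw [hypDist_origin] at h1
    have h2 := Real.sinh_le_sinh.2 ((le_div_iff₀' two_pos).2 h1)
    rwa [Real.sinh_arsinh, div_le_iff₀ (Real.sqrt_pos.2 hpos)] at h2
  have h0 : ‖y₀‖ ≤ Real.sinh (R / 2) * √(1 - ‖y₀‖ ^ 2) := by
    refine le_of_tendsto_of_tendsto' hlim.norm ?_ hle
    exact (((hlim.norm.pow 2).const_sub 1).sqrt).const_mul _
  by_contra! h
  rw [Real.sqrt_eq_zero_of_nonpos (by nlinarith), mul_zero] at h0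
  linarith

theorem norm_eq_one_of_lt_hypDist {y : ℕ → H3} {y₀ : E3}
    (hR : ∀ n : ℕ, (n : ℝ) < hypDist origin (y n))
    (hlim : Tendsto (fun n => (y n : E3)) atTop (𝓝 y₀)) : ‖y₀‖ = 1 := by
  refine le_antisymm (le_of_tendsto' hlim.norm fun n => (mem_ball_zero_iff.1 (y n).2).le) ?_
  by_contra! h
  have hpos := one_sub_norm_sq_pos h
  have h1 : Tendsto (fun n => hypDist origin (y n)) atTop
      (𝓝 (2 * Real.arsinh (‖y₀‖ / √(1 - ‖y₀‖ ^ 2)))) := by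
    simp only [hypDist_origin]
    refine Tendsto.const_mul 2 ((Real.continuous_arsinh.tendsto _).comp ?_)
    exact hlim.norm.div ((hlim.norm.pow 2).const_sub 1).sqrt (Real.sqrt_pos.2 hpos).ne'
  exact not_tendsto_nhds_of_tendsto_atTop
    (tendsto_atTop_mono (fun n => (hR n).le) tendsto_natCast_atTop_atTop) _ h1

theorem integral_mobius_limit {d : ℕ} (hd : 1 ≤ d) {f : ℕ → Rat d} {F : RatBar d} {y₀ : E3}
    (hf : Tendsto (fun n => (f n : RatBar d)) atTop (𝓝 F))
    (hy : Tendsto (fun n => (barycentricExtension (sphereMap (f n)) origin : E3)) atTop (𝓝 y₀))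
    (hF : ∀ᵐ ζ ∂sphereMeasure, sphereValue F ζ ≠ y₀) :
    ∫ ζ, mobius (-y₀) (sphereValue F ζ) ∂sphereMeasure = 0 := by
  have h := tendsto_integral_mobius_neg (μ := sphereMeasure)
    (g := fun n ζ => sphereValue (f n).1 ζ) (g₀ := sphereValue F)
    (fun n => mem_ball_zero_iff.1 (barycentricExtension (sphereMap (f n)) origin).2)
    (fun n => measurable_sphereValue _) (fun n => norm_sphereValue (f n)) hy
    ((ae_tendsto_sphereValue hf).and hF)
  simp only [integral_mobius_barycentricExtension hd] at h
  exact (tendsto_nhds_unique h tendsto_const_nhds)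

theorem not_hasDegree_zero_of_bounded {d : ℕ} (hd : 1 ≤ d) {f : ℕ → Rat d} {R : ℝ}
    (hR : ∀ n, hypDist origin (barycentricExtension (sphereMap (f n)) origin) ≤ R)
    {F : RatBar d} (hF : F ∈ limitSet fun n => (f n : RatBar d)) : ¬ HasDegree F 0 := by
  intro hdeg
  obtain ⟨φ, hφ, hlim⟩ := hF
  obtain ⟨c, hc, hae⟩ := hdeg.ae_sphereValue_eq
  obtain ⟨y₀, -, ψ, hψ, hy⟩ := (isCompact_closedBall (0 : E3) 1).tendsto_subseq
    (x := fun n => (barycentricExtension (sphereMap (f (φ n))) origin : E3))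
    fun n => Metric.ball_subset_closedBall (Subtype.prop _)
  have hy1 : ‖y₀‖ < 1 := norm_lt_one_of_hypDist_le (fun n => hR (φ (ψ n))) hy
  have h := integral_mobius_limit hd (f := fun n => f (φ (ψ n)))
    (hlim.comp hψ.tendsto_atTop) hy (by
      filter_upwards [hae] with ζ hζ h'
      rw [← h', hζ] at hy1
      linarith)
  rw [integral_congr_ae (g := fun _ => mobius (-y₀) c) (hae.mono fun ζ hζ => by
    simp only [hζ])] at h
  have h1 := norm_mobius_neg hy1 hc
  simp only [integral_const, probReal_univ, one_smul] at h
  rw [h, norm_zero] at h1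
  norm_num at h1

theorem exists_hasDegree_zero_of_unbounded {d : ℕ} (hd : 1 ≤ d) {f : ℕ → Rat d}
    (hR : ¬ ∃ R : ℝ, ∀ n, hypDist origin (barycentricExtension (sphereMap (f n)) origin) ≤ R) :
    ∃ F ∈ limitSet (fun n => (f n : RatBar d)), HasDegree F 0 := by
  -- An eventual bound would be a global one, since only finitely many terms are left out.
  have hfreq : ∀ k : ℕ, ∃ᶠ n in atTop,
      (k : ℝ) < hypDist origin (barycentricExtension (sphereMap (f n)) origin) := by
    intro k hk
    have hb : IsBoundedUnder (· ≤ ·) atTop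
        fun n => hypDist origin (barycentricExtension (sphereMap (f n)) origin) :=
      ⟨k, eventually_map.2 (hk.mono fun n hn => not_lt.1 hn)⟩
    obtain ⟨R, h⟩ := hb.bddAbove_range
    exact hR ⟨R, fun n => h ⟨n, rfl⟩⟩
  obtain ⟨φ, hφ, hlt⟩ := extraction_forall_of_frequently hfreq
  obtain ⟨y₀, -, ψ, hψ, hy⟩ := (isCompact_closedBall (0 : E3) 1).tendsto_subseq
    (x := fun n => (barycentricExtension (sphereMap (f (φ n))) origin : E3))
    fun n => Metric.ball_subset_closedBall (Subtype.prop _)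
  obtain ⟨F, χ, hχ, hF⟩ := exists_tendsto_subseq fun n => (f (φ (ψ n)) : RatBar d)
  refine ⟨F, ⟨φ ∘ ψ ∘ χ, hφ.comp (hψ.comp hχ), hF⟩, ?_⟩
  by_contra hdeg
  have hy1 : ‖y₀‖ = 1 := norm_eq_one_of_lt_hypDist
    (y := fun n => barycentricExtension (sphereMap (f (φ (ψ n)))) origin)
    -- Since n ≤ ψ n, the distances still exceed n after the second extraction.
    (fun n => (Nat.cast_le.2 (hψ.le_apply)).trans_lt (hlt (ψ n))) hy
  have hae := ae_sphereValue_ne hdeg y₀ hy1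
  have h := integral_mobius_limit hd (f := fun n => f (φ (ψ (χ n)))) hF
    (hy.comp hχ.tendsto_atTop) hae
  have hnorm : ∀ᵐ ζ ∂sphereMeasure, ‖sphereValue F ζ‖ = 1 := by
    filter_upwards [ae_evalPair_ne_zero F.rep_nonzero] with ζ hζ
    exact norm_stereoVec hζ
  rw [integral_congr_ae (g := fun _ => -y₀) (hae.mp (hnorm.mono fun ζ h1 h2 =>
    mobius_neg_of_norm_eq_one hy1 h1 h2))] at h
  simp only [integral_const, probReal_univ, one_smul, neg_eq_zero] at h
  rw [h, norm_zero] at hy1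
  norm_num at hy1

end BarExt
end

theorem mainTheorem11 (d : ℕ) (hd : 1 ≤ d) (f : ℕ → BarExt.Rat d) :
    (∀ n, ∃! y : BarExt.H3, BarExt.BalancedAt
      (BarExt.sphereMeasure.map
        (BarExt.sphereMap (f n) ∘ BarExt.mobiusSphere BarExt.origin)) y) ∧
    ((∃ R : ℝ, ∀ n, BarExt.hypDist BarExt.origin
        (BarExt.barycentricExtension (BarExt.sphereMap (f n)) BarExt.origin) ≤ R) ↔
      ∀ F ∈ BarExt.limitSet (fun n => (f n : BarExt.RatBar d)), ¬ BarExt.HasDegree F 0) := by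
  refine ⟨fun n => BarExt.existsUnique_balancedAt_pushMeasure hd (f n), ?_, ?_⟩
  · rintro ⟨R, hR⟩ F hF
    exact BarExt.not_hasDegree_zero_of_bounded hd hR hF
  · intro h
    by_contra hR
    obtain ⟨F, hF, hdeg⟩ := BarExt.exists_hasDegree_zero_of_unbounded hd hR
    exact h F hF hdeg
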